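/- Consider $n\ge 1$ agents and $m$ resources, where agent $a$ has utility $u_a(r)\in\{0,1\}$ for resource $r$ and additive utility $u_a(B)=\sum_{r\in B}u_a(r)$ for a set $B$ of resources. An allocation $\pi$ assigns to each agent $a$ a set $\pi(a)$ of resources, sets of distinct agents being disjoint (not all resources need be allocated). It is envy-free if $u_a(\pi(a'))\le u_a(\pi(a))$ for all agents $a,a'$, and its egalitarian welfare is $\min_a u_a(\pi(a))$. Given the utilities and an integer threshold $t\ge 0$, the question is whether there is an envy-free allocation with egalitarian welfare at least $t$. There is a random access machine program (unit cost per operation; the numbers $n,m,t$ are given in registers and the matrix $(u_a(r))$ in memory) and a constant $C$ such that for all $n\ge 1$, $m$, $t$ and all $0/1$ utilities, the program decides this question in at most $C\cdot\max(1,m)^{2.5}$ steps; that is, the problem is solvable in $O(m^{2.5})$ time, where the constant depends on neither $n$ nor $t$. Moreover, such an allocation exists if and only if the bipartite graph whose one side consists of $t$ copies of each agent and whose other side consists of the resources, a copy of $a$ being adjacent to $r$ exactly when $u_a(r)=1$, has a matching that saturates the agent side. -/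

import Mathlib

/-! ### Allocations of indivisible resources -/

namespace FairDivision

variable {A R : Type*}

/-- Additive utility of agent `a` for the set `B` of resources. -/
def bundleUtility (u : A → R → ℕ) (a : A) (B : Finset R) : ℕ :=
  ∑ r ∈ B, u a r

/-- A (possibly partial) allocation: the bundles of distinct agents are disjoint. -/
def IsAllocation (π : A → Finset R) : Prop :=
  ∀ a a' : A, a ≠ a' → Disjoint (π a) (π a')

/-- No agent prefers the bundle of another agent to their own. -/
def EnvyFree (u : A → R → ℕ) (π : A → Finset R) : Prop :=
  ¬ ∃ a a' : A, bundleUtility u a (π a) < bundleUtility u a (π a')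

/-- Egalitarian social welfare: the minimum of the agents' utilities for their own bundles. -/
def esw [Fintype A] [Nonempty A] (u : A → R → ℕ) (π : A → Finset R) : ℕ :=
  Finset.univ.inf' Finset.univ_nonempty fun a => bundleUtility u a (π a)

/-- Every utility value is `0` or `1`. -/
def IsBinary (u : A → R → ℕ) : Prop :=
  ∀ a r, u a r = 0 ∨ u a r = 1

/-- The question: is there an envy-free allocation with egalitarian welfare at least `t`? -/
def HasEnvyFreeESW [Fintype A] [Nonempty A] (u : A → R → ℕ) (t : ℕ) : Prop :=
  ∃ π : A → Finset R, IsAllocation π ∧ EnvyFree u π ∧ t ≤ esw u π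

/-- The bipartite graph with `t` copies of each agent on one side and the resources on the other;
a copy of an agent is adjacent to the resources that the agent likes. -/
def copyGraph (u : A → R → ℕ) (t : ℕ) : SimpleGraph ((A × Fin t) ⊕ R) where
  Adj
    | Sum.inl x, Sum.inr r => u x.1 r = 1
    | Sum.inr r, Sum.inl x => u x.1 r = 1
    | _, _ => False
  symm := ⟨by rintro (x | r) (y | r') h <;> exact h⟩
  loopless := ⟨by rintro (x | r) h <;> exact h⟩

/-- The graph has a matching that covers every vertex of the agent side. -/
def HasAgentSaturatingMatching (u : A → R → ℕ) (t : ℕ) : Prop :=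
  ∃ M : (copyGraph u t).Subgraph, M.IsMatching ∧ ∀ x : A × Fin t, Sum.inl x ∈ M.verts

end FairDivision

/-! ### A random access machine with a step count

Programs are finite structured programs over natural-number registers and doubly indexed arrays
with indirect addressing. The only arithmetic operations are successor and (truncated)
predecessor, so that the numbers occurring in a run exceed the input numbers by at most the number
of steps made plus a constant of the program: charging one unit per operation is legitimate. -/

namespace RAM

/-- A memory state: registers, and arrays `arr k` with entries `arr k i j`. -/
structure State where
  reg : ℕ → ℕ
  arr : ℕ → ℕ → ℕ → ℕ

/-- Arithmetic expressions. Register names and array names are literals of the program;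
array indices are computed. -/
inductive Expr where
  | const (k : ℕ)
  | reg (x : ℕ)
  | succ (e : Expr)
  | pred (e : Expr)
  | get (k : ℕ) (i j : Expr)

/-- Value of an expression. -/
def Expr.eval (s : State) : Expr → ℕ
  | .const k => k
  | .reg x => s.reg x
  | .succ e => e.eval s + 1
  | .pred e => e.eval s - 1
  | .get k i j => s.arr k (i.eval s) (j.eval s)

/-- Cost of evaluating an expression: one unit per operation. -/
def Expr.cost : Expr → ℕ
  | .const _ => 1
  | .reg _ => 1
  | .succ e => e.cost + 1
  | .pred e => e.cost + 1
  | .get _ i j => i.cost + j.cost + 1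

/-- Tests. -/
inductive Test where
  | lt (e f : Expr)
  | eq (e f : Expr)
  | neg (b : Test)
  | conj (b c : Test)

/-- Truth of a test. -/
def Test.Holds (s : State) : Test → Prop
  | .lt e f => e.eval s < f.eval s
  | .eq e f => e.eval s = f.eval s
  | .neg b => ¬ b.Holds s
  | .conj b c => b.Holds s ∧ c.Holds s

/-- Cost of a test: one unit per operation. -/
def Test.cost : Test → ℕ
  | .lt e f => e.cost + f.cost + 1
  | .eq e f => e.cost + f.cost + 1
  | .neg b => b.cost + 1
  | .conj b c => b.cost + c.cost + 1

/-- Programs. -/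
inductive Program where
  | skip
  | assign (x : ℕ) (e : Expr)
  | set (k : ℕ) (i j e : Expr)
  | seq (p q : Program)
  | ite (b : Test) (p q : Program)
  | loop (b : Test) (p : Program)

/-- The state after writing `v` into register `x`. -/
def State.setReg (s : State) (x v : ℕ) : State :=
  { s with reg := fun y => if y = x then v else s.reg y }

/-- The state after writing `v` into the entry `(i, j)` of array `k`. -/
def State.setArr (s : State) (k i j v : ℕ) : State :=
  { s with arr := fun k' i' j' => if k' = k ∧ i' = i ∧ j' = j then v else s.arr k' i' j' }

/-- `Exec p s s' c`: started in state `s`, the program `p` halts in state `s'` after `c` steps.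
The constructor `loop b p` of programs is "while `b` do `p`". -/
inductive Exec : Program → State → State → ℕ → Prop
  | skip (s : State) : Exec .skip s s 1
  | assign (x : ℕ) (e : Expr) (s : State) :
      Exec (.assign x e) s (s.setReg x (e.eval s)) (e.cost + 1)
  | set (k : ℕ) (i j e : Expr) (s : State) :
      Exec (.set k i j e) s (s.setArr k (i.eval s) (j.eval s) (e.eval s))
        (i.cost + j.cost + e.cost + 1)
  | seq {p q : Program} {s s' s'' : State} {c d : ℕ} :
      Exec p s s' c → Exec q s' s'' d → Exec (.seq p q) s s'' (c + d)
  | ite_true {b : Test} {p q : Program} {s s' : State} {c : ℕ} :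
      b.Holds s → Exec p s s' c → Exec (.ite b p q) s s' (b.cost + c + 1)
  | ite_false {b : Test} {p q : Program} {s s' : State} {c : ℕ} :
      ¬ b.Holds s → Exec q s s' c → Exec (.ite b p q) s s' (b.cost + c + 1)
  | loop_done {b : Test} {p : Program} {s : State} :
      ¬ b.Holds s → Exec (.loop b p) s s (b.cost + 1)
  | loop_step {b : Test} {p : Program} {s s' s'' : State} {c d : ℕ} :
      b.Holds s → Exec p s s' c → Exec (.loop b p) s' s'' d →
        Exec (.loop b p) s s'' (b.cost + c + d + 1)

/-- The machine is deterministic: final state and number of steps are unique. -/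
theorem Exec.unique {p : Program} {s s₁ s₂ : State} {c₁ c₂ : ℕ}
    (h₁ : Exec p s s₁ c₁) (h₂ : Exec p s s₂ c₂) : s₁ = s₂ ∧ c₁ = c₂ := by
  induction h₁ generalizing s₂ c₂ with
  | skip => cases h₂; exact ⟨rfl, rfl⟩
  | assign => cases h₂; exact ⟨rfl, rfl⟩
  | set => cases h₂; exact ⟨rfl, rfl⟩
  | seq _ _ ih ih' =>
    cases h₂ with
    | seq h h' =>
      obtain ⟨rfl, rfl⟩ := ih h
      obtain ⟨rfl, rfl⟩ := ih' h'
      exact ⟨rfl, rfl⟩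
  | ite_true hb _ ih =>
    cases h₂ with
    | ite_true _ h => obtain ⟨rfl, rfl⟩ := ih h; exact ⟨rfl, rfl⟩
    | ite_false hb' => exact absurd hb hb'
  | ite_false hb _ ih =>
    cases h₂ with
    | ite_true hb' => exact absurd hb' hb
    | ite_false _ h => obtain ⟨rfl, rfl⟩ := ih h; exact ⟨rfl, rfl⟩
  | loop_done hb =>
    cases h₂ with
    | loop_done => exact ⟨rfl, rfl⟩
    | loop_step hb' => exact absurd hb' hb
  | loop_step hb _ _ ih ih' =>
    cases h₂ with
    | loop_done hb' => exact absurd hb hb'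
    | loop_step _ h h' =>
      obtain ⟨rfl, rfl⟩ := ih h
      obtain ⟨rfl, rfl⟩ := ih' h'
      exact ⟨rfl, rfl⟩

/-- The input: registers `0`, `1`, `2` hold the number `n` of agents, the number `m` of resources
and the threshold `t`; array `0` holds the utility matrix; everything else is zero. -/
def input {n m : ℕ} (u : Fin n → Fin m → ℕ) (t : ℕ) : State where
  reg x := if x = 0 then n else if x = 1 then m else if x = 2 then t else 0
  arr k i j := if h : k = 0 ∧ i < n ∧ j < m then u ⟨i, h.2.1⟩ ⟨j, h.2.2⟩ else 0

/-- Started in state `s`, the program `p` halts after at most `T` steps, and register `0` then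
holds `1` if `Q` is true and `0` if `Q` is false. -/
def Decides (p : Program) (s : State) (T : ℝ) (Q : Prop) : Prop :=
  ∃ (s' : State) (c : ℕ), Exec p s s' c ∧ (c : ℝ) ≤ T ∧
    ((Q ∧ s'.reg 0 = 1) ∨ (¬ Q ∧ s'.reg 0 = 0))

end RAM

/-! Envy-freeness costs nothing. If every agent can get `t` liked resources, keep exactly `t` of
them per agent and discard the rest: each agent values the own bundle at `t` and any other, having
at most `t` elements, at no more. So the question is whether each agent can be given `t` liked
resources, all distinct, which is a matching saturating the `n * t` copies (`hasEnvyFreeESW_iff`,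
`hasAgentSaturatingMatching_iff`).

For `t = 0` the answer is yes, for `n * t > m` it is no. Listing stops at `m + 1` copies, and for `t
> 0` every agent passed contributes one, so this takes O(m) steps whatever `n` and `t` are. What
remains is a matching problem with at most `m` vertices on each side, and a price cap `K` of order
`√m` splits the work.

In the auction an unmatched copy takes a cheapest liked resource, raises its price by one and
displaces the owner; it withdraws once all its liked resources cost `K`. There are at most `m * K`
bids, each an O(m) scan. If a saturating matching exists, counting on the level sets of the prices
bounds the number `g` of withdrawn copies by `g * K ≤ m` (`IsAuction.mul_le`), hence `g ≤ K` by the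
choice of `K` (`postponed_le`); more withdrawals mean no.

Each withdrawn copy then gets a depth-first search for an augmenting path. It visits each resource
at most once, so it costs O(m²), and a search stuck at its root exhibits a violation of Hall's
condition (`IsSearch.not_saturable`). Both phases take O(m² K) = O(m^2.5) steps. -/

/-! ### Reasoning about programs -/

namespace RAM

/-- Started in `s`, the program halts, and final state and number of steps satisfy `Q`. -/
def Yields (p : Program) (s : State) (Q : State → ℕ → Prop) : Prop :=
  ∃ (s' : State) (c : ℕ), Exec p s s' c ∧ Q s' c

theorem Yields.mono {p : Program} {s : State} {Q Q' : State → ℕ → Prop}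
    (h : Yields p s Q) (hQ : ∀ s' c, Q s' c → Q' s' c) : Yields p s Q' := by
  obtain ⟨s', c, he, hq⟩ := h
  exact ⟨s', c, he, hQ _ _ hq⟩

/-- This and the next equivalences are weakest-precondition rules. As rewrite rules they let `simp`
execute loop-free code symbolically, step count included. -/
theorem yields_skip {s : State} {Q : State → ℕ → Prop} : Yields .skip s Q ↔ Q s 1 := by
  constructor
  · rintro ⟨s', c, he, hq⟩
    cases he
    exact hq
  · exact fun h => ⟨_, _, .skip s, h⟩

theorem yields_assign {x : ℕ} {e : Expr} {s : State} {Q : State → ℕ → Prop} :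
    Yields (.assign x e) s Q ↔ Q (s.setReg x (e.eval s)) (e.cost + 1) := by
  constructor
  · rintro ⟨s', c, he, hq⟩
    cases he
    exact hq
  · exact fun h => ⟨_, _, .assign x e s, h⟩

theorem yields_set {k : ℕ} {i j e : Expr} {s : State} {Q : State → ℕ → Prop} :
    Yields (.set k i j e) s Q ↔
      Q (s.setArr k (i.eval s) (j.eval s) (e.eval s)) (i.cost + j.cost + e.cost + 1) := by
  constructor
  · rintro ⟨s', c, he, hq⟩
    cases he
    exact hq
  · exact fun h => ⟨_, _, .set k i j e s, h⟩

theorem yields_seq {p q : Program} {s : State} {Q : State → ℕ → Prop} :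
    Yields (.seq p q) s Q ↔ Yields p s fun s' c => Yields q s' fun s'' d => Q s'' (c + d) := by
  constructor
  · rintro ⟨s', c, he, hq⟩
    cases he with
    | seq h h' => exact ⟨_, _, h, _, _, h', hq⟩
  · rintro ⟨_, _, h, _, _, h', hq⟩
    exact ⟨_, _, .seq h h', hq⟩

theorem yields_ite {b : Test} {p q : Program} {s : State} {Q : State → ℕ → Prop} :
    Yields (.ite b p q) s Q ↔
      (b.Holds s → Yields p s fun s' c => Q s' (b.cost + c + 1)) ∧
      (¬ b.Holds s → Yields q s fun s' c => Q s' (b.cost + c + 1)) := by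
  constructor
  · rintro ⟨s', c, he, hq⟩
    cases he with
    | ite_true hb h => exact ⟨fun _ => ⟨_, _, h, hq⟩, fun hb' => absurd hb hb'⟩
    | ite_false hb h => exact ⟨fun hb' => absurd hb' hb, fun _ => ⟨_, _, h, hq⟩⟩
  · rintro ⟨h₁, h₂⟩
    by_cases hb : b.Holds s
    · obtain ⟨_, _, h, hq⟩ := h₁ hb
      exact ⟨_, _, .ite_true hb h, hq⟩
    · obtain ⟨_, _, h, hq⟩ := h₂ hb
      exact ⟨_, _, .ite_false hb h, hq⟩

/-- A loop whose body takes at most `D` steps and decreases the counter of the invariant `I`. -/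
theorem yields_loop {b : Test} {p : Program} (I : ℕ → State → Prop) (D : ℕ)
    (step : ∀ k s, I k s → b.Holds s → Yields p s fun s' c => c ≤ D ∧ ∃ k' < k, I k' s')
    (k : ℕ) (s : State) (h : I k s) :
    Yields (.loop b p) s fun s' c =>
      c ≤ k * (D + b.cost + 1) + b.cost + 1 ∧ ¬ b.Holds s' ∧ ∃ k', I k' s' := by
  induction k using Nat.strong_induction_on generalizing s with
  | _ k ih =>
    by_cases hb : b.Holds s
    · obtain ⟨s', c, he, hc, k', hk, hI⟩ := step k s h hb
      obtain ⟨s'', d, he', hd, hq⟩ := ih k' hk s' hI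
      refine ⟨s'', _, .loop_step hb he he', ?_, hq⟩
      -- The drop of the counter by at least one pays for the body, the test and the loop overhead.
      have : (k' + 1) * (D + b.cost + 1) ≤ k * (D + b.cost + 1) := Nat.mul_le_mul_right _ hk
      rw [Nat.add_mul] at this
      omega
    · exact ⟨s, _, .loop_done hb, by omega, hb, k, h⟩

@[simp] theorem setReg_reg (s : State) (x v y : ℕ) :
    (s.setReg x v).reg y = if y = x then v else s.reg y := rfl

@[simp] theorem setReg_arr (s : State) (x v : ℕ) : (s.setReg x v).arr = s.arr := rfl

@[simp] theorem setArr_reg (s : State) (k i j v : ℕ) : (s.setArr k i j v).reg = s.reg := rfl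

@[simp] theorem setArr_arr (s : State) (k i j v k' i' j' : ℕ) :
    (s.setArr k i j v).arr k' i' j' =
      if k' = k ∧ i' = i ∧ j' = j then v else s.arr k' i' j' := rfl

end RAM

/-! ### Bipartite matching: auctions with a price cap and alternating searches

The left vertices are `1, …, N`, the right vertices `0, …, m - 1`. A matching is given by the
function `own` that maps a right vertex to its partner, or to `0` if it has none. -/

namespace BipartiteMatching

/-- Some matching covers all left vertices. -/
def Saturable (adj : ℕ → ℕ → Prop) (N m : ℕ) : Prop :=
  ∃ f : ℕ → ℕ, (∀ x, 1 ≤ x → x ≤ N → f x < m ∧ adj x (f x)) ∧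
    ∀ x y, 1 ≤ x → x ≤ N → 1 ≤ y → y ≤ N → f x = f y → x = y

/-- `own` is a matching, and `cur` (if nonzero), the vertices beyond `next` and the `g` vertices
listed by `G` are precisely the left vertices it does not cover. -/
structure IsPartial (adj : ℕ → ℕ → Prop) (N m : ℕ) (own G : ℕ → ℕ) (g next cur : ℕ) : Prop where
  cur_le : cur ≤ next
  next_le : next ≤ N
  own_le : ∀ r < m, own r ≤ next
  own_adj : ∀ r < m, own r ≠ 0 → adj (own r) r
  own_inj : ∀ r < m, ∀ r' < m, own r ≠ 0 → own r = own r' → r = r'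
  own_ne_cur : cur ≠ 0 → ∀ r < m, own r ≠ cur
  own_ne_list : ∀ i < g, ∀ r < m, own r ≠ G i
  covers : ∀ x, 1 ≤ x → x ≤ next → x = cur ∨ (∃ i < g, G i = x) ∨ ∃ r < m, own r = x
  list_inj : ∀ i < g, ∀ j < g, G i = G j → i = j
  list_pos : ∀ i < g, 1 ≤ G i
  list_le : ∀ i < g, G i ≤ next
  list_ne : ∀ i < g, G i ≠ cur

namespace IsPartial

variable {adj : ℕ → ℕ → Prop} {N m g next cur : ℕ} {own G : ℕ → ℕ}

theorem start (h : IsPartial adj N m own G g next 0) (hn : next < N) :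
    IsPartial adj N m own G g (next + 1) (next + 1) := by
  obtain ⟨h1, h2, h3, h4, h5, h6, h7, h8, h9, h10, h11, h12⟩ := h
  constructor <;> grind

theorem assign (h : IsPartial adj N m own G g next cur) (hc : cur ≠ 0) {b : ℕ} (hb : b < m)
    (ha : adj cur b) :
    IsPartial adj N m (fun r => if r = b then cur else own r) G g next (own b) := by
  obtain ⟨h1, h2, h3, h4, h5, h6, h7, h8, h9, h10, h11, h12⟩ := h
  constructor <;> grind

theorem giveUp (h : IsPartial adj N m own G g next cur) (hc : cur ≠ 0) :
    IsPartial adj N m own (fun i => if i = g then cur else G i) (g + 1) next 0 := by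
  obtain ⟨h1, h2, h3, h4, h5, h6, h7, h8, h9, h10, h11, h12⟩ := h
  constructor
  case covers =>
    intro x hx hx'
    obtain rfl | ⟨i, hi, e⟩ | hr := h8 x hx hx'
    · exact .inr (.inl ⟨g, by omega, by simp⟩)
    · exact .inr (.inl ⟨i, by omega, by rw [if_neg (by omega), e]⟩)
    · exact .inr (.inr hr)
  all_goals grind

theorem resume (h : IsPartial adj N m own G (g + 1) next 0) :
    IsPartial adj N m own G g next (G g) := by
  obtain ⟨h1, h2, h3, h4, h5, h6, h7, h8, h9, h10, h11, h12⟩ := h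
  constructor <;> grind

theorem saturable (h : IsPartial adj N m own G 0 N 0) : Saturable adj N m := by
  have h' : ∀ x, ∃ r, 1 ≤ x → x ≤ N → r < m ∧ own r = x := by
    intro x
    by_cases hx : 1 ≤ x ∧ x ≤ N
    · obtain h0 | ⟨i, hi, -⟩ | ⟨r, hr, e⟩ := h.covers x hx.1 hx.2
      · omega
      · omega
      · exact ⟨r, fun _ _ => ⟨hr, e⟩⟩
    · exact ⟨0, fun h1 h2 => absurd ⟨h1, h2⟩ hx⟩
  choose f hf using h'
  refine ⟨f, fun x h1 h2 => ⟨(hf x h1 h2).1, ?_⟩, fun x y h1 h2 h3 h4 e => ?_⟩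
  · have := h.own_adj (f x) (hf x h1 h2).1
    rw [(hf x h1 h2).2] at this
    exact this (by omega)
  · rw [← (hf x h1 h2).2, e, (hf y h3 h4).2]

end IsPartial

/-! ### Auctions with a price cap -/

/-- The invariant of an auction with price cap `K`. -/
structure IsAuction (adj : ℕ → ℕ → Prop) (N m K : ℕ) (own price G : ℕ → ℕ) (g next cur : ℕ) :
    Prop extends IsPartial adj N m own G g next cur where
  price_le : ∀ r < m, price r ≤ K
  price_free : ∀ r < m, own r = 0 → price r = 0
  slack : ∀ r < m, own r ≠ 0 → ∀ r' < m, adj (own r) r' → price r ≤ price r' + 1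
  exhausted : ∀ i < g, ∀ r < m, adj (G i) r → K ≤ price r

namespace IsAuction

variable {adj : ℕ → ℕ → Prop} {N m K g next cur : ℕ} {own price G : ℕ → ℕ}

theorem start (h : IsAuction adj N m K own price G g next 0) (hn : next < N) :
    IsAuction adj N m K own price G g (next + 1) (next + 1) :=
  ⟨h.toIsPartial.start hn, h.price_le, h.price_free, h.slack, h.exhausted⟩

/-- The bidder takes a cheapest neighbour, so after the raise by one it still pays at most one more
than any alternative. For all other owners slack survives because prices never fall. -/
theorem bid (h : IsAuction adj N m K own price G g next cur) (hc : cur ≠ 0) {b : ℕ} (hb : b < m)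
    (ha : adj cur b) (hK : price b < K) (hmin : ∀ r < m, adj cur r → price b ≤ price r) :
    IsAuction adj N m K (fun r => if r = b then cur else own r)
      (fun r => if r = b then price b + 1 else price r) G g next (own b) := by
  obtain ⟨h0, h1, h2, h3, h4⟩ := h
  refine ⟨h0.assign hc hb ha, ?_, ?_, ?_, ?_⟩
  · grind
  · grind
  · grind
  · grind

theorem giveUp (h : IsAuction adj N m K own price G g next cur) (hc : cur ≠ 0)
    (hK : ∀ r < m, adj cur r → K ≤ price r) :
    IsAuction adj N m K own price (fun i => if i = g then cur else G i) (g + 1) next 0 := by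
  obtain ⟨h0, h1, h2, h3, h4⟩ := h
  refine ⟨h0.giveUp hc, h1, h2, h3, ?_⟩
  grind

/-- The room left below the cap is the potential that bounds the number of bids. -/
theorem sum_bid {b : ℕ} (hb : b < m) (hK : price b < K) :
    ∑ r ∈ Finset.range m, (K - if r = b then price b + 1 else price r) <
      ∑ r ∈ Finset.range m, (K - price r) := by
  apply Finset.sum_lt_sum
  · intro r _
    split_ifs with h
    · subst h; omega
    · exact le_rfl
  · exact ⟨b, Finset.mem_range.2 hb, by simp only [if_pos]; omega⟩

/-- If all left vertices can be covered, few of them withdraw from the auction. -/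
theorem mul_le (h : IsAuction adj N m K own price G g N 0) (hs : Saturable adj N m) :
    g * K ≤ m := by
  classical
  obtain ⟨f, hf, finj⟩ := hs
  let T : ℕ → Finset ℕ := fun j => (Finset.range m).filter fun r => j ≤ price r
  -- Resources of positive price have owners. By slack, owners of resources priced at least `j + 2`
  -- like only resources priced at least `j + 1`; so do the withdrawn vertices, since `j + 1 ≤ K`.
  -- The covering `f` injects both groups into `T (j + 1)`.
  have key : ∀ j, j < K → (T (j + 2)).card + g ≤ (T (j + 1)).card := by
    intro j hj
    let X := (T (j + 2)).image own ∪ (Finset.range g).image G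
    have hX : X.card = (T (j + 2)).card + g := by
      rw [Finset.card_union_of_disjoint, Finset.card_image_of_injOn, Finset.card_image_of_injOn,
        Finset.card_range]
      · intro i hi i' hi' e
        simp only [Finset.coe_range, Set.mem_Iio] at hi hi'
        exact h.list_inj i hi i' hi' e
      · intro r hr r' hr' e
        simp only [T, Finset.coe_filter, Finset.mem_range, Set.mem_ofPred_eq] at hr hr'
        refine h.own_inj r hr.1 r' hr'.1 (fun h0 => ?_) e
        have := h.price_free r hr.1 h0
        omega
      · rw [Finset.disjoint_left]
        intro x hx hx'
        simp only [T, Finset.mem_image, Finset.mem_filter, Finset.mem_range] at hx hx'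
        obtain ⟨r, hr, rfl⟩ := hx
        obtain ⟨i, hi, e⟩ := hx'
        exact h.own_ne_list i hi r hr.1 e.symm
    have hX' : ∀ x ∈ X, 1 ≤ x ∧ x ≤ N ∧ ∀ r < m, adj x r → j + 1 ≤ price r := by
      intro x hx
      simp only [X, T, Finset.mem_union, Finset.mem_image, Finset.mem_filter,
        Finset.mem_range] at hx
      obtain ⟨r, hr, rfl⟩ | ⟨i, hi, rfl⟩ := hx
      · have h0 : own r ≠ 0 := fun h0 => by
          have := h.price_free r hr.1 h0
          omega
        refine ⟨by omega, h.own_le r hr.1, fun r' hr' ha => ?_⟩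
        have := h.slack r hr.1 h0 r' hr' ha
        omega
      · refine ⟨h.list_pos i hi, h.list_le i hi, fun r hr ha => ?_⟩
        have := h.exhausted i hi r hr ha
        omega
    rw [← hX]
    refine Finset.card_le_card_of_injOn f (fun x hx => ?_) (fun x hx y hy e => ?_)
    · obtain ⟨h1, h2, h3⟩ := hX' x hx
      simp only [T, Finset.coe_filter, Finset.mem_range, Set.mem_ofPred_eq]
      exact ⟨(hf x h1 h2).1, h3 _ (hf x h1 h2).1 (hf x h1 h2).2⟩
    · obtain ⟨h1, h2, -⟩ := hX' x hx
      obtain ⟨h3, h4, -⟩ := hX' y hy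
      exact finj x y h1 h2 h3 h4 e
  have tele : ∀ j, j ≤ K → (T (j + 1)).card + g * j ≤ m := by
    intro j
    induction j with
    | zero =>
      intro _
      have := Finset.card_filter_le (Finset.range m) fun r => 0 + 1 ≤ price r
      rw [Finset.card_range] at this
      simpa using this
    | succ j ih =>
      intro hj
      have h1 := ih (by omega)
      have h2 : (T (j + 1 + 1)).card + g ≤ (T (j + 1)).card := key j (by omega)
      rw [Nat.mul_succ]
      omega
  have := tele K le_rfl
  omega

end IsAuction

/-! ### Alternating searches -/

/-- The right vertices in `S` lead back from `x` to `root` along an alternating path. -/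
def IsTrail (adj : ℕ → ℕ → Prop) (own prev : ℕ → ℕ) (root : ℕ) : ℕ → List ℕ → Prop
  | x, [] => x = root
  | x, r :: S => prev x = r ∧ adj x r ∧ IsTrail adj own prev root (own r) S

theorem IsTrail.root_owns {adj : ℕ → ℕ → Prop} {own prev : ℕ → ℕ} {root x : ℕ} {S : List ℕ}
    (h : IsTrail adj own prev root x S) : S = [] ∨ ∃ r ∈ S, own r = root := by
  induction S generalizing x with
  | nil => exact .inl rfl
  | cons r S ih =>
    right
    obtain rfl | ⟨r', hr', e⟩ := ih h.2.2
    · exact ⟨r, by simp, h.2.2⟩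
    · exact ⟨r', by simp [hr'], e⟩

theorem IsTrail.congr {adj : ℕ → ℕ → Prop} {own own' prev prev' : ℕ → ℕ} {root x : ℕ}
    {S : List ℕ} (h : IsTrail adj own prev root x S) (hown : ∀ r ∈ S, own' r = own r)
    (hx : prev' x = prev x) (hprev : ∀ r ∈ S, prev' (own r) = prev (own r)) :
    IsTrail adj own' prev' root x S := by
  induction S generalizing x with
  | nil => exact h
  | cons r S ih =>
    refine ⟨hx.trans h.1, h.2.1, ?_⟩
    rw [hown r (by simp)]
    exact ih h.2.2 (fun r' h' => hown r' (by simp [h'])) (hprev r (by simp))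
      (fun r' h' => hprev r' (by simp [h']))

/-- The invariant of a search for an augmenting path from `root`. The visited right vertices are
those with mark at least `bound`; those not on the current trail `S` are done with. -/
structure IsSearch (adj : ℕ → ℕ → Prop) (N m : ℕ) (own mark prev G : ℕ → ℕ)
    (g cur bound root : ℕ) (S : List ℕ) : Prop extends IsPartial adj N m own G g N cur where
  mark_le : ∀ r < m, mark r ≤ bound
  trail : IsTrail adj own prev root cur S
  nodup : S.Nodup
  lt_of_mem : ∀ r ∈ S, r < m
  visited_of_mem : ∀ r ∈ S, bound ≤ mark r
  own_of_visited : ∀ r < m, bound ≤ mark r → own r ≠ 0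
  closed : ∀ r < m, bound ≤ mark r → r ∈ S ∨ ∀ r' < m, adj (own r) r' → bound ≤ mark r'

namespace IsSearch

variable {adj : ℕ → ℕ → Prop} {N m g cur bound root : ℕ} {own mark prev G : ℕ → ℕ} {S : List ℕ}

theorem start (h : IsPartial adj N m own G (g + 1) N 0) (hm : ∀ r < m, mark r ≤ bound) :
    IsSearch adj N m own mark prev G g (G g) (bound + 1) (G g) [] := by
  refine ⟨h.resume, ?_, rfl, by simp, by simp, by simp, ?_, ?_⟩
  · grind
  · grind
  · grind

/-- The matching is changed while searching: `cur` takes `b` at once and the displaced owner goes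
on. Thus `own` is always a matching, and reaching a free vertex completes the augmentation with no
path to flip. -/
theorem forward (h : IsSearch adj N m own mark prev G g cur bound root S) (hc : cur ≠ 0) {b : ℕ}
    (hb : b < m) (ha : adj cur b) (hv : mark b < bound) (hy : own b ≠ 0) :
    IsSearch adj N m (fun r => if r = b then cur else own r)
      (fun r => if r = b then bound else mark r) (fun x => if x = own b then b else prev x)
      G g (own b) bound root (b :: S) := by
  have hbS : b ∉ S := fun hbS => by
    have := h.visited_of_mem b hbS
    omega
  have hS : ∀ r ∈ S, r ≠ b := fun r hr e => hbS (e ▸ hr)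
  obtain ⟨h0, h1, h2, h3, h4, h5, h6, h7⟩ := h
  refine ⟨h0.assign hc hb ha, ?_, ⟨by simp, h0.own_adj b hb hy, ?_⟩, List.nodup_cons.2 ⟨hbS, h3⟩,
    ?_, ?_, ?_, ?_⟩
  · grind
  · simp only [if_pos]
    -- The old trail does not see the update of `prev` at `own b`: `cur` is unmatched, and the
    -- owners along `S` differ from `own b` because `b` is not in `S`.
    refine h2.congr (fun r hr => if_neg (hS r hr)) (if_neg ?_) (fun r hr => if_neg fun e => ?_)
    · exact fun e => h0.own_ne_cur hc b hb e.symm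
    · exact hS r hr (h0.own_inj b hb r (h4 r hr) hy e.symm).symm
  · grind
  · grind
  · grind
  · grind

theorem partial_of_free (h : IsSearch adj N m own mark prev G g cur bound root S) (hc : cur ≠ 0)
    {b : ℕ} (hb : b < m) (ha : adj cur b) (hy : own b = 0) :
    IsPartial adj N m (fun r => if r = b then cur else own r) G g N 0 := by
  have := h.toIsPartial.assign hc hb ha
  rwa [hy] at this

/-- On a nonempty trail the root owns one of the trail's resources, while `cur` owns none. -/
theorem eq_nil_iff (h : IsSearch adj N m own mark prev G g cur bound root S) (hc : cur ≠ 0) :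
    S = [] ↔ cur = root := by
  constructor
  · rintro rfl
    exact h.trail
  · rintro rfl
    obtain e | ⟨r, hr, e⟩ := h.trail.root_owns
    · exact e
    · exact absurd e (h.own_ne_cur hc r (h.lt_of_mem r hr))

/-- This undoes the last forward move: `cur` takes its former resource back and the vertex that had
displaced it becomes current. The resource may leave the trail because all neighbours of its
restored owner are visited. -/
theorem backtrack (h : IsSearch adj N m own mark prev G g cur bound root S) (hc : cur ≠ 0)
    (hroot : cur ≠ root) (hd : ∀ r < m, adj cur r → bound ≤ mark r) :
    ∃ S', S = prev cur :: S' ∧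
      IsSearch adj N m (fun r => if r = prev cur then cur else own r) mark prev G g
        (own (prev cur)) bound root S' := by
  obtain _ | ⟨r, S'⟩ := S
  · exact absurd h.trail hroot
  obtain ⟨rfl, ha, ht⟩ := h.trail
  have hnd := List.nodup_cons.1 h.nodup
  have hr := h.lt_of_mem (prev cur) (by simp)
  refine ⟨S', rfl, h.toIsPartial.assign hc hr ha, h.mark_le, ?_, hnd.2,
    fun r h' => h.lt_of_mem r (by simp [h']), fun r h' => h.visited_of_mem r (by simp [h']), ?_, ?_⟩
  · exact ht.congr (fun r h' => if_neg fun (e : r = prev cur) => hnd.1 (e ▸ h')) rfl fun _ _ => rfl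
  · have := h.own_of_visited
    grind
  · intro r h1 h2
    by_cases e : r = prev cur
    · right
      simpa only [if_pos e] using hd
    · have := h.closed r h1 h2
      simpa [e] using this

/-- When the search is stuck at its root, the left vertices cannot all be covered. -/
theorem not_saturable (h : IsSearch adj N m own mark prev G g cur bound root S) (hc : cur ≠ 0)
    (hroot : cur = root) (hd : ∀ r < m, adj cur r → bound ≤ mark r) : ¬ Saturable adj N m := by
  classical
  rintro ⟨f, hf, finj⟩
  have hS := (h.eq_nil_iff hc).2 hroot
  subst hS
  -- The trail is empty, so by `closed` the owners of `V`, and also `cur`, have all their neighbours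
  -- in `V`: these are `V.card + 1` vertices, against Hall's condition.
  let V := (Finset.range m).filter fun r => bound ≤ mark r
  let X := insert cur (V.image own)
  have hV : ∀ r ∈ V, r < m ∧ bound ≤ mark r := fun r hr => by simpa [V] using hr
  have hX : X.card = V.card + 1 := by
    rw [Finset.card_insert_of_notMem, Finset.card_image_of_injOn]
    · intro r hr r' hr' e
      exact h.own_inj r (hV r hr).1 r' (hV r' hr').1 (h.own_of_visited r (hV r hr).1 (hV r hr).2) e
    · intro hx
      obtain ⟨r, hr, e⟩ := Finset.mem_image.1 hx
      exact h.own_ne_cur hc r (hV r hr).1 e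
  have hX' : ∀ x ∈ X, 1 ≤ x ∧ x ≤ N ∧ ∀ r < m, adj x r → bound ≤ mark r := by
    intro x hx
    obtain rfl | hx := Finset.mem_insert.1 hx
    · exact ⟨by omega, h.cur_le, hd⟩
    · obtain ⟨r, hr, rfl⟩ := Finset.mem_image.1 hx
      have := h.own_of_visited r (hV r hr).1 (hV r hr).2
      refine ⟨by omega, h.own_le r (hV r hr).1, ?_⟩
      exact (h.closed r (hV r hr).1 (hV r hr).2).resolve_left (by simp)
  have : X.card ≤ V.card := by
    refine Finset.card_le_card_of_injOn f (fun x hx => ?_) (fun x hx y hy e => ?_)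
    · obtain ⟨h1, h2, h3⟩ := hX' x hx
      have := hf x h1 h2
      simp only [V, Finset.coe_filter, Finset.mem_range, Set.mem_ofPred_eq]
      exact ⟨this.1, h3 _ this.1 this.2⟩
    · obtain ⟨h1, h2, -⟩ := hX' x hx
      obtain ⟨h3, h4, -⟩ := hX' y hy
      exact finj x y h1 h2 h3 h4 e
  omega

theorem card_forward {b : ℕ} (hb : b < m) (hv : mark b < bound) :
    ((Finset.range m).filter fun r => (if r = b then bound else mark r) < bound).card <
      ((Finset.range m).filter fun r => mark r < bound).card := by
  apply Finset.card_lt_card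
  refine ⟨fun r hr => ?_, fun hr => ?_⟩
  · simp only [Finset.mem_filter, Finset.mem_range] at hr ⊢
    by_cases e : r = b
    · simp [e] at hr
    · simpa [e] using hr
  · have := hr (show b ∈ _ by simp [hb, hv])
    simp at this

end IsSearch

end BipartiteMatching

/-! ### The program

Registers: `0` number of agents and result, `1` number of resources, `2` threshold, `3` number of
left vertices, `4` agent, `5` copy of the agent, `6` price cap, `7` bound for prices and marks,
`8` current left vertex, `9` right vertex, `10` best right vertex, `11` its price, `12` number of
left vertices introduced, `13` number of postponed left vertices, `14` root of the search,
`15` previous owner, `16` failure flag, `17` auxiliary counter.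

Arrays: `0` utilities, `1` agents of the left vertices, `2` owners, `3` prices and marks,
`5` predecessors in the search, `6` postponed left vertices. -/

namespace RAM

open BipartiteMatching

/-- List the copies of the agents in array `1`, stopping when there are more than resources. -/
def copies : Program :=
  .loop (.conj (.lt (.reg 4) (.reg 0)) (.lt (.reg 3) (.succ (.reg 1))))
    (.ite (.lt (.reg 5) (.reg 2))
      (.seq (.assign 3 (.succ (.reg 3)))
        (.seq (.set 1 (.reg 3) (.const 0) (.reg 4)) (.assign 5 (.succ (.reg 5)))))
      (.seq (.assign 4 (.succ (.reg 4))) (.assign 5 (.const 0))))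

/-- Compute a price cap of order square root of the number of resources. -/
def priceCap : Program :=
  .seq (.assign 7 (.reg 1))
    (.seq
      (.loop (.lt (.const 0) (.reg 7))
        (.ite (.lt (.reg 17) (.reg 6))
          (.seq (.assign 7 (.pred (.reg 7))) (.assign 17 (.succ (.reg 17))))
          (.seq (.assign 6 (.succ (.reg 6))) (.assign 17 (.const 0)))))
      (.assign 7 (.reg 6)))

/-- Find a cheapest resource with price below the bound that the current left vertex likes. -/
def scan : Program :=
  .seq (.assign 9 (.const 0))
    (.seq (.assign 10 (.reg 1))
      (.seq (.assign 11 (.reg 7))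
        (.loop (.lt (.reg 9) (.reg 1))
          (.seq
            (.ite (.conj (.eq (.get 0 (.get 1 (.reg 8) (.const 0)) (.reg 9)) (.const 1))
                (.lt (.get 3 (.reg 9) (.const 0)) (.reg 11)))
              (.seq (.assign 10 (.reg 9)) (.assign 11 (.get 3 (.reg 9) (.const 0))))
              .skip)
            (.assign 9 (.succ (.reg 9)))))))

/-- The current left vertex takes the best right vertex; the previous owner becomes current. -/
def exchange : Program :=
  .seq (.assign 15 (.get 2 (.reg 10) (.const 0)))
    (.seq (.set 2 (.reg 10) (.const 0) (.reg 8)) (.assign 8 (.reg 15)))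

/-- Let the left vertices bid for right vertices; postpone those that reach the price cap. -/
def auction : Program :=
  .loop (.neg (.conj (.eq (.reg 12) (.reg 3)) (.eq (.reg 8) (.const 0))))
    (.ite (.eq (.reg 8) (.const 0))
      (.seq (.assign 12 (.succ (.reg 12))) (.assign 8 (.reg 12)))
      (.seq scan
        (.ite (.lt (.reg 10) (.reg 1))
          (.seq (.set 3 (.reg 10) (.const 0) (.succ (.get 3 (.reg 10) (.const 0)))) exchange)
          (.seq (.set 6 (.reg 13) (.const 0) (.reg 8))
            (.seq (.assign 13 (.succ (.reg 13))) (.assign 8 (.const 0)))))))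

/-- Search augmenting paths from the postponed left vertices. -/
def augment : Program :=
  .loop (.neg (.conj (.eq (.reg 13) (.const 0)) (.eq (.reg 8) (.const 0))))
    (.ite (.eq (.reg 8) (.const 0))
      (.seq (.assign 13 (.pred (.reg 13)))
        (.seq (.assign 8 (.get 6 (.reg 13) (.const 0)))
          (.seq (.assign 14 (.reg 8)) (.assign 7 (.succ (.reg 7))))))
      (.seq scan
        (.ite (.lt (.reg 10) (.reg 1))
          (.seq (.set 3 (.reg 10) (.const 0) (.reg 7))
            (.seq (.set 5 (.get 2 (.reg 10) (.const 0)) (.const 0) (.reg 10)) exchange))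
          (.ite (.eq (.reg 8) (.reg 14))
            (.seq (.assign 16 (.const 1))
              (.seq (.assign 13 (.const 0)) (.assign 8 (.const 0))))
            (.seq (.assign 10 (.get 5 (.reg 8) (.const 0))) exchange)))))

/-- The whole decision procedure. -/
def decideESW : Program :=
  .ite (.eq (.reg 2) (.const 0)) (.assign 0 (.const 1))
    (.seq copies
      (.ite (.lt (.reg 1) (.reg 3)) (.assign 0 (.const 0))
        (.seq priceCap
          (.seq auction
            (.ite (.lt (.reg 6) (.reg 13)) (.assign 0 (.const 0))
              (.seq augment
                (.ite (.eq (.reg 16) (.const 0)) (.assign 0 (.const 1))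
                  (.assign 0 (.const 0)))))))))

/-- Left vertex `x` likes right vertex `r`, as stored in memory. -/
def Likes (s : State) (x r : ℕ) : Prop := s.arr 0 (s.arr 1 x 0) r = 1

/-! ### Correctness and cost of the subroutines -/

/-- The value `m` in register `10` encodes that nothing was found. One scan serves both phases:
below the bound means affordable in the auction and unvisited in the search. -/
theorem scan_spec (s : State) :
    Yields scan s fun s' c => c ≤ 40 * s.reg 1 + 20 ∧ s'.arr = s.arr ∧
      (∀ x, x ≠ 9 → x ≠ 10 → x ≠ 11 → s'.reg x = s.reg x) ∧
      ((s'.reg 10 < s.reg 1 ∧ Likes s (s.reg 8) (s'.reg 10) ∧ s.arr 3 (s'.reg 10) 0 < s.reg 7 ∧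
          ∀ r < s.reg 1, Likes s (s.reg 8) r → s.arr 3 (s'.reg 10) 0 ≤ s.arr 3 r 0) ∨
        (s'.reg 10 = s.reg 1 ∧ ∀ r < s.reg 1, Likes s (s.reg 8) r → s.reg 7 ≤ s.arr 3 r 0)) := by
  simp only [scan, yields_seq, yields_assign]
  refine (yields_loop (fun k s' => s'.arr = s.arr ∧
      (∀ x, x ≠ 9 → x ≠ 10 → x ≠ 11 → s'.reg x = s.reg x) ∧
      s'.reg 9 ≤ s.reg 1 ∧ s.reg 1 - s'.reg 9 = k ∧
      ((s'.reg 10 < s.reg 1 ∧ Likes s (s.reg 8) (s'.reg 10) ∧ s.arr 3 (s'.reg 10) 0 < s.reg 7 ∧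
          s'.reg 11 = s.arr 3 (s'.reg 10) 0 ∧
          ∀ r < s'.reg 9, Likes s (s.reg 8) r → s.arr 3 (s'.reg 10) 0 ≤ s.arr 3 r 0) ∨
        (s'.reg 10 = s.reg 1 ∧ s'.reg 11 = s.reg 7 ∧
          ∀ r < s'.reg 9, Likes s (s.reg 8) r → s.reg 7 ≤ s.arr 3 r 0))) 30
    ?_ (s.reg 1) _ ?_).mono ?_
  · rintro k s' ⟨harr, hreg, h9, hk, hbest⟩ hb
    have e1 := hreg 1 (by decide) (by decide) (by decide)
    have e8 := hreg 8 (by decide) (by decide) (by decide)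
    simp only [Test.Holds, Expr.eval, e1] at hb
    simp only [yields_seq, yields_ite, yields_assign, yields_skip, Test.Holds, Expr.eval,
      Test.cost, Expr.cost, setReg_reg, setReg_arr, harr, e8]
    have hL : s.arr 0 (s.arr 1 (s.reg 8) 0) (s'.reg 9) = 1 ↔ Likes s (s.reg 8) (s'.reg 9) :=
      Iff.rfl
    simp only [hL]
    constructor
    · rintro ⟨hl, hlt⟩
      refine ⟨by norm_num, s.reg 1 - (s'.reg 9 + 1), by omega, trivial, ?_, ?_⟩
      · intro x h1 h2 h3
        simp [h1, h2, h3, hreg x h1 h2 h3]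
      · norm_num
        grind
    · intro hl
      refine ⟨by norm_num, s.reg 1 - (s'.reg 9 + 1), by omega, trivial, ?_, ?_⟩
      · intro x h1 h2 h3
        simp [h1, hreg x h1 h2 h3]
      · norm_num
        grind
  · refine ⟨rfl, ?_, ?_⟩
    · intro x h1 h2 h3
      simp [h1, h2, h3]
    · simp [Expr.eval]
  · rintro s' c ⟨hc, hb, k, harr, hreg, h9, -, hbest⟩
    have e1 := hreg 1 (by decide) (by decide) (by decide)
    simp only [Test.Holds, Expr.eval, e1] at hb
    simp only [Test.cost, Expr.cost] at hc ⊢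
    have e9 : s'.reg 9 = s.reg 1 := by omega
    rw [e9] at hbest
    refine ⟨by omega, harr, hreg, ?_⟩
    grind

/-- Either there are more copies than resources, or all copies are listed. -/
theorem copies_spec (s : State) (ht : 0 < s.reg 2) (h3 : s.reg 3 = 0) (h4 : s.reg 4 = 0)
    (h5 : s.reg 5 = 0) :
    Yields copies s fun s' c => c ≤ 100 * (s.reg 1 + 1) ∧
      (∀ k, k ≠ 1 → s'.arr k = s.arr k) ∧
      (∀ x, x ≠ 3 → x ≠ 4 → x ≠ 5 → s'.reg x = s.reg x) ∧
      ((s.reg 1 < s'.reg 3 ∧ s.reg 1 < s.reg 0 * s.reg 2) ∨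
        (s'.reg 3 ≤ s.reg 1 ∧ s'.reg 3 = s.reg 0 * s.reg 2 ∧
          ∀ x, 1 ≤ x → x ≤ s'.reg 3 → s'.arr 1 x 0 = (x - 1) / s.reg 2)) := by
  refine (yields_loop (fun k s' => (∀ k, k ≠ 1 → s'.arr k = s.arr k) ∧
      (∀ x, x ≠ 3 → x ≠ 4 → x ≠ 5 → s'.reg x = s.reg x) ∧
      s'.reg 3 = s'.reg 4 * s.reg 2 + s'.reg 5 ∧ s'.reg 5 ≤ s.reg 2 ∧ s'.reg 3 ≤ s.reg 1 + 1 ∧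
      (s'.reg 4 < s.reg 0 ∨ s'.reg 4 = s.reg 0 ∧ s'.reg 5 = 0) ∧
      (∀ x, 1 ≤ x → x ≤ s'.reg 3 → s'.arr 1 x 0 = (x - 1) / s.reg 2) ∧
      -- Listing a copy gains two and loses at most one. Passing to the next agent gains one, since
      -- register `5` then drops from `t > 0` to zero.
      2 * (s.reg 1 + 1 - s'.reg 3) + min (s'.reg 5) 1 = k) 30
    ?_ (2 * (s.reg 1 + 1)) s ?_).mono ?_
  · rintro k s' ⟨harr, hreg, hN, hj, hle, ha, hag, hk⟩ hb
    have e0 := hreg 0 (by decide) (by decide) (by decide)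
    have e1 := hreg 1 (by decide) (by decide) (by decide)
    have e2 := hreg 2 (by decide) (by decide) (by decide)
    simp only [Test.Holds, Expr.eval, e0, e1] at hb
    simp only [yields_seq, yields_ite, yields_assign, yields_set, Test.Holds, Expr.eval,
      Test.cost, Expr.cost, setReg_reg, setReg_arr, setArr_reg, setArr_arr, e2]
    constructor
    · intro hlt
      refine ⟨by norm_num, _, ?_, ?_, ?_, ?_, ?_, ?_, ?_, ?_, rfl⟩
      · norm_num
        omega
      · intro k hk
        funext i j
        simp [hk, harr k hk]
      · intro x h1 h2 h3
        simp [h1, h3, hreg x h1 h2 h3]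
      · norm_num
        omega
      · norm_num
        omega
      · norm_num
        omega
      · norm_num
        omega
      · norm_num
        intro x h1 h2
        split_ifs with e
        · symm
          rw [e, Nat.add_sub_cancel, hN]
          rw [Nat.div_eq_iff ht]
          omega
        · exact hag x h1 (by omega)
    · intro hge
      have hj' : s'.reg 5 = s.reg 2 := by omega
      refine ⟨by norm_num, _, ?_, ?_, ?_, ?_, ?_, ?_, ?_, ?_, rfl⟩
      · norm_num
        omega
      · exact harr
      · intro x h1 h2 h3
        simp [h2, h3, hreg x h1 h2 h3]
      · norm_num
        rw [Nat.add_mul]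
        omega
      · norm_num
      · norm_num
        omega
      · norm_num
        omega
      · norm_num
        exact hag
  · exact ⟨fun _ _ => rfl, fun _ _ _ _ => rfl, by rw [h3, h4, h5]; omega, by omega, by omega,
      by omega, fun x h1 h2 => by omega, by rw [h3, h5]; simp⟩
  · rintro s' c ⟨hc, hb, k, harr, hreg, hN, hj, hle, ha, hag, -⟩
    have e0 := hreg 0 (by decide) (by decide) (by decide)
    have e1 := hreg 1 (by decide) (by decide) (by decide)
    simp only [Test.Holds, Expr.eval, e0, e1] at hb
    simp only [Test.cost, Expr.cost] at hc ⊢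
    refine ⟨by omega, harr, hreg, ?_⟩
    by_cases hm : s'.reg 3 ≤ s.reg 1
    · right
      have ha' : s'.reg 4 = s.reg 0 ∧ s'.reg 5 = 0 := by omega
      refine ⟨hm, ?_, hag⟩
      rw [hN, ha'.1, ha'.2, Nat.add_zero]
    · left
      refine ⟨by omega, ?_⟩
      obtain h | ⟨h, h'⟩ := ha
      · have : (s'.reg 4 + 1) * s.reg 2 ≤ s.reg 0 * s.reg 2 := Nat.mul_le_mul_right _ h
        rw [Nat.add_mul] at this
        omega
      · rw [h, h'] at hN
        omega

/-- Without multiplication, a root is found by removing blocks of sizes 0, 1, 2, … from `m`. With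
`K` in register `6` and `i` in register `17`, the amount removed is `K * (K - 1) / 2 + i` with `i ≤
K`, which gives both bounds at the end. -/
theorem priceCap_spec (s : State) (h6 : s.reg 6 = 0) (h17 : s.reg 17 = 0) :
    Yields priceCap s fun s' c => c ≤ 100 * (s.reg 1 + 1) ∧ s'.arr = s.arr ∧
      (∀ x, x ≠ 6 → x ≠ 7 → x ≠ 17 → s'.reg x = s.reg x) ∧ s'.reg 7 = s'.reg 6 ∧
      2 * s.reg 1 ≤ s'.reg 6 * s'.reg 6 + s'.reg 6 ∧
      s'.reg 6 * s'.reg 6 ≤ 2 * s.reg 1 + s'.reg 6 := by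
  simp only [priceCap, yields_seq, yields_assign]
  refine (yields_loop (fun k s' => s'.arr = s.arr ∧
      (∀ x, x ≠ 6 → x ≠ 7 → x ≠ 17 → s'.reg x = s.reg x) ∧
      s'.reg 6 * s'.reg 6 + 2 * s'.reg 7 + 2 * s'.reg 17 = 2 * s.reg 1 + s'.reg 6 ∧
      s'.reg 17 ≤ s'.reg 6 ∧ 2 * s'.reg 7 + (s'.reg 17 + 1 - s'.reg 6) = k) 30
    ?_ (2 * s.reg 1 + 1) _ ?_).mono ?_
  · rintro k s' ⟨harr, hreg, hK, hi, hk⟩ hb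
    simp only [Test.Holds, Expr.eval] at hb
    simp only [yields_seq, yields_ite, yields_assign, Test.Holds, Expr.eval,
      Test.cost, Expr.cost, setReg_reg, setReg_arr]
    constructor
    · intro hlt
      refine ⟨by norm_num, _, ?_, harr, ?_, ?_, ?_, rfl⟩
      · norm_num
        omega
      · intro x h1 h2 h3
        simp [h2, h3, hreg x h1 h2 h3]
      · norm_num
        omega
      · norm_num
        omega
    · intro hge
      refine ⟨by norm_num, _, ?_, harr, ?_, ?_, ?_, rfl⟩
      · norm_num
        omega
      · intro x h1 h2 h3
        simp [h1, h3, hreg x h1 h2 h3]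
      · norm_num
        nlinarith
      · norm_num
  · refine ⟨rfl, ?_, ?_⟩
    · intro x h1 h2 h3
      simp [h2]
    · simp [Expr.eval, h6, h17]
  · rintro s' c ⟨hc, hb, k, harr, hreg, hK, hi, -⟩
    simp only [Test.Holds, Expr.eval] at hb
    simp only [Test.cost, Expr.cost, Expr.eval, setReg_reg, setReg_arr] at hc ⊢
    refine ⟨by omega, harr, ?_, by norm_num, ?_, ?_⟩
    · intro x h1 h2 h3
      simp [h2, hreg x h1 h2 h3]
    · norm_num
      omega
    · norm_num
      omega

/-- Besides the room below the cap, the potential charges two for each vertex not yet introduced and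
one for a current vertex, so introductions and withdrawals decrease it too. In the bound, 109 is 100
for the body's overhead plus 9 for the test and the loop. -/
theorem auction_spec (s : State) (h8 : s.reg 8 = 0) (h12 : s.reg 12 = 0) (h13 : s.reg 13 = 0)
    (h7 : s.reg 7 = s.reg 6) (h2 : ∀ r, s.arr 2 r 0 = 0) (h3 : ∀ r, s.arr 3 r 0 = 0) :
    Yields auction s fun s' c =>
      c ≤ (s.reg 1 * s.reg 6 + 2 * s.reg 3) * (40 * s.reg 1 + 109) + 9 ∧
      (∀ k, k ≠ 2 → k ≠ 3 → k ≠ 6 → s'.arr k = s.arr k) ∧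
      (∀ x, x < 8 ∨ 15 < x → s'.reg x = s.reg x) ∧ s'.reg 8 = 0 ∧
      IsAuction (Likes s) (s.reg 3) (s.reg 1) (s.reg 6) (fun r => s'.arr 2 r 0)
        (fun r => s'.arr 3 r 0) (fun i => s'.arr 6 i 0) (s'.reg 13) (s.reg 3) 0 := by
  refine (yields_loop (fun k s' => (∀ k, k ≠ 2 → k ≠ 3 → k ≠ 6 → s'.arr k = s.arr k) ∧
      (∀ x, x < 8 ∨ 15 < x → s'.reg x = s.reg x) ∧
      IsAuction (Likes s) (s.reg 3) (s.reg 1) (s.reg 6) (fun r => s'.arr 2 r 0)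
        (fun r => s'.arr 3 r 0) (fun i => s'.arr 6 i 0) (s'.reg 13) (s'.reg 12) (s'.reg 8) ∧
      ∑ r ∈ Finset.range (s.reg 1), (s.reg 6 - s'.arr 3 r 0) + 2 * (s.reg 3 - s'.reg 12) +
        min (s'.reg 8) 1 = k) (40 * s.reg 1 + 100)
    ?_ (s.reg 1 * s.reg 6 + 2 * s.reg 3) s ?_).mono ?_
  · rintro k s' ⟨harr, hreg, hA, hk⟩ hb
    have e1 := hreg 1 (by decide)
    have e3 := hreg 3 (by decide)
    have e7 := hreg 7 (by decide)
    have hL : Likes s' = Likes s := by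
      funext x r
      simp only [Likes, harr 0 (by decide) (by decide) (by decide),
        harr 1 (by decide) (by decide) (by decide)]
    simp only [Test.Holds, Expr.eval, e3] at hb
    simp only [yields_seq, yields_ite, yields_assign, Test.Holds, Expr.eval,
      Test.cost, Expr.cost, setReg_reg, setReg_arr]
    constructor
    · intro h0
      have hlt : s'.reg 12 < s.reg 3 := by
        have := hA.next_le
        omega
      refine ⟨by omega, _, ?_, harr, ?_, ?_, rfl⟩
      · norm_num
        omega
      · intro x hx
        rw [if_neg (by omega), if_neg (by omega), hreg x hx]
      · norm_num
        rw [h0] at hA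
        exact hA.start hlt
    · intro h0
      refine (scan_spec s').mono ?_
      rintro s₁ c ⟨hc, harr₁, hreg₁, hbest⟩
      rw [e1] at hc
      have f1 := hreg₁ 1 (by decide) (by decide) (by decide)
      have f8 := hreg₁ 8 (by decide) (by decide) (by decide)
      have f12 := hreg₁ 12 (by decide) (by decide) (by decide)
      have f13 := hreg₁ 13 (by decide) (by decide) (by decide)
      simp only [exchange, yields_seq, yields_assign, yields_set, Expr.eval,
        Expr.cost, setReg_reg, setReg_arr, setArr_reg, setArr_arr, harr₁, f1, e1, f8,
        f12, f13]
      rw [hL, e1, e7, h7] at hbest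
      constructor
      · intro hlt
        obtain ⟨-, ha, hp, hmin⟩ := hbest.resolve_right (by omega)
        have hA' := hA.bid h0 hlt ha hp hmin
        have hsum := IsAuction.sum_bid (price := fun r => s'.arr 3 r 0) hlt hp
        refine ⟨by omega, _, ?_, ?_, ?_, ?_, rfl⟩
        · norm_num
          omega
        · intro k h1 h2 h3
          funext i j
          simp [h1, h2, harr₁, harr k h1 h2 h3]
        · intro x hx
          rw [if_neg (by omega), if_neg (by omega), hreg₁ x (by omega) (by omega) (by omega),
            hreg x hx]
        · norm_num
          exact hA'
      · intro hge
        obtain ⟨-, hK⟩ := hbest.resolve_left (by omega)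
        have hA' := hA.giveUp h0 hK
        refine ⟨by omega, _, ?_, ?_, ?_, ?_, rfl⟩
        · norm_num
          omega
        · intro k h1 h2 h3
          funext i j
          simp [h3, harr₁, harr k h1 h2 h3]
        · intro x hx
          rw [if_neg (by omega), if_neg (by omega), hreg₁ x (by omega) (by omega) (by omega),
            hreg x hx]
        · norm_num
          exact hA'
  · refine ⟨fun _ _ _ _ => rfl, fun _ _ => rfl, ⟨⟨?_, ?_, ?_, ?_, ?_, ?_, ?_, ?_, ?_, ?_, ?_, ?_⟩,
      ?_, ?_, ?_, ?_⟩, ?_⟩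
    all_goals simp [h8, h12, h13, h2, h3]
    omega
  · rintro s' c ⟨hc, hb, k, harr, hreg, hA, -⟩
    have e3 := hreg 3 (by decide)
    simp only [Test.Holds, Expr.eval, not_not, e3] at hb
    rw [hb.1, hb.2] at hA
    exact ⟨hc, harr, hreg, hb.2, hA⟩

theorem augment_spec (s : State) (h16 : s.reg 16 = 0) (h8 : s.reg 8 = 0)
    (hP : IsPartial (Likes s) (s.reg 3) (s.reg 1) (fun r => s.arr 2 r 0) (fun i => s.arr 6 i 0)
      (s.reg 13) (s.reg 3) 0) (hmark : ∀ r < s.reg 1, s.arr 3 r 0 ≤ s.reg 7) :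
    Yields augment s fun s' c =>
      c ≤ s.reg 13 * (2 * s.reg 1 + 2) * (40 * s.reg 1 + 109) + 9 ∧
      (Saturable (Likes s) (s.reg 3) (s.reg 1) ↔ s'.reg 16 = 0) := by
  refine (yields_loop (fun k s' => (∀ k, k ≠ 2 → k ≠ 3 → k ≠ 5 → s'.arr k = s.arr k) ∧
      (∀ x, x < 7 → s'.reg x = s.reg x) ∧
      -- Three phases: between searches, searching, failed. Each postponed vertex carries a budget
      -- of `2 * m + 2`, where a search uses two per unvisited resource and one per trail element. A
      -- forward move turns two into one; a backtrack spends that one.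
      ((s'.reg 16 = 0 ∧ s'.reg 8 = 0 ∧
          IsPartial (Likes s) (s.reg 3) (s.reg 1) (fun r => s'.arr 2 r 0) (fun i => s'.arr 6 i 0)
            (s'.reg 13) (s.reg 3) 0 ∧
          (∀ r < s.reg 1, s'.arr 3 r 0 ≤ s'.reg 7) ∧ s'.reg 13 * (2 * s.reg 1 + 2) ≤ k) ∨
        (s'.reg 16 = 0 ∧ s'.reg 8 ≠ 0 ∧ ∃ S,
          IsSearch (Likes s) (s.reg 3) (s.reg 1) (fun r => s'.arr 2 r 0) (fun r => s'.arr 3 r 0)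
            (fun x => s'.arr 5 x 0) (fun i => s'.arr 6 i 0) (s'.reg 13) (s'.reg 8) (s'.reg 7)
            (s'.reg 14) S ∧
          s'.reg 13 * (2 * s.reg 1 + 2) +
            2 * ((Finset.range (s.reg 1)).filter fun r => s'.arr 3 r 0 < s'.reg 7).card +
            S.length + 1 ≤ k) ∨
        (s'.reg 16 = 1 ∧ s'.reg 13 = 0 ∧ s'.reg 8 = 0 ∧
          ¬ Saturable (Likes s) (s.reg 3) (s.reg 1)))) (40 * s.reg 1 + 100)
    ?_ (s.reg 13 * (2 * s.reg 1 + 2)) s ?_).mono ?_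
  · rintro k s' ⟨harr, hreg, hI⟩ hb
    have e1 := hreg 1 (by decide)
    have hL : Likes s' = Likes s := by
      funext x r
      simp only [Likes, harr 0 (by decide) (by decide) (by decide),
        harr 1 (by decide) (by decide) (by decide)]
    simp only [Test.Holds, Expr.eval] at hb
    simp only [yields_seq, yields_ite, yields_assign, Test.Holds, Expr.eval,
      Test.cost, Expr.cost, setReg_reg, setReg_arr]
    constructor
    · intro h0
      obtain ⟨h16, -, hP, hm, hk⟩ | ⟨-, h0', -⟩ | ⟨-, h13, -, -⟩ := hI
      · obtain ⟨g, hg⟩ : ∃ g, s'.reg 13 = g + 1 := ⟨s'.reg 13 - 1, by omega⟩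
        rw [hg] at hP
        have hG : s'.arr 6 g 0 ≠ 0 := by
          have := hP.list_pos g (by omega)
          omega
        have hF : ((Finset.range (s.reg 1)).filter fun r => s'.arr 3 r 0 ≤ s'.reg 7).card ≤
            s.reg 1 := by
          simpa using Finset.card_filter_le (Finset.range (s.reg 1))
            fun r => s'.arr 3 r 0 ≤ s'.reg 7
        refine ⟨by omega, k - 1, ?_, harr, ?_, .inr (.inl ⟨?_, ?_, [], ?_, ?_⟩)⟩
        · rw [hg, Nat.add_mul] at hk
          omega
        · intro x hx
          simp only [hreg x hx]
          grind
        · norm_num [h16]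
        · norm_num [hg, hG]
        · norm_num [hg]
          -- Raising the bound by one makes all resources unvisited without resetting marks. The
          -- first search reuses the final prices as marks, as they are at most `K`.
          exact IsSearch.start hP hm
        · norm_num [hg]
          rw [hg, Nat.add_mul] at hk
          omega
      · exact absurd h0 h0'
      · omega
    · intro h0
      obtain ⟨-, h0', -⟩ | ⟨h16, -, S, hS, hk⟩ | ⟨-, -, h0', -⟩ := hI
      · exact absurd h0' h0
      · refine (scan_spec s').mono ?_
        rintro s₁ c ⟨hc, harr₁, hreg₁, hbest⟩
        rw [e1] at hc
        have f1 := hreg₁ 1 (by decide) (by decide) (by decide)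
        have f7 := hreg₁ 7 (by decide) (by decide) (by decide)
        have f8 := hreg₁ 8 (by decide) (by decide) (by decide)
        have f13 := hreg₁ 13 (by decide) (by decide) (by decide)
        have f14 := hreg₁ 14 (by decide) (by decide) (by decide)
        have f16 := hreg₁ 16 (by decide) (by decide) (by decide)
        simp only [exchange, yields_seq, yields_assign, yields_set, Expr.eval,
          Expr.cost, setReg_reg, setReg_arr, setArr_reg, setArr_arr, harr₁, f1, e1, f7,
          f8, f13, f14, f16]
        rw [hL, e1] at hbest
        constructor
        · intro hlt
          obtain ⟨-, ha, hp, -⟩ := hbest.resolve_right (by omega)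
          have hF := IsSearch.card_forward (mark := fun r => s'.arr 3 r 0) hlt hp
          refine ⟨by omega, k - 1, by omega, ?_, ?_, ?_⟩
          · intro k h1 h2 h3
            funext i j
            simp [h1, h2, h3, harr₁, harr k h1 h2 h3]
          · intro x hx
            rw [if_neg (by omega), if_neg (by omega), hreg₁ x (by omega) (by omega) (by omega),
              hreg x hx]
          -- If the resource was free, the displaced owner is `0`, which ends the search; the
          -- predecessor written at index `0` is never used.
          · by_cases hy : s'.arr 2 (s₁.reg 10) 0 = 0
            · left
              refine ⟨?_, ?_, ?_, ?_, ?_⟩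
              · norm_num [h16]
              · norm_num [hy]
              · norm_num
                exact hS.partial_of_free h0 hlt ha hy
              · norm_num
                intro r hr
                split_ifs
                · exact le_rfl
                · exact hS.mark_le r hr
              · norm_num
                omega
            · right; left
              refine ⟨?_, ?_, s₁.reg 10 :: S, ?_, ?_⟩
              · norm_num [h16]
              · norm_num [hy]
              · norm_num
                exact hS.forward h0 hlt ha hp hy
              · norm_num
                omega
        · intro hge
          obtain ⟨-, hd⟩ := hbest.resolve_left (by omega)
          constructor
          · intro hroot
            refine ⟨by omega, k - 1, by omega, harr, ?_, ?_⟩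
            · intro x hx
              rw [if_neg (by omega), if_neg (by omega), if_neg (by omega),
                hreg₁ x (by omega) (by omega) (by omega), hreg x hx]
            · right; right
              norm_num
              exact hS.not_saturable h0 hroot hd
          · intro hroot
            obtain ⟨S', rfl, hS'⟩ := hS.backtrack h0 hroot hd
            have hne : s'.arr 2 (s'.arr 5 (s'.reg 8) 0) 0 ≠ 0 :=
              hS.own_of_visited _ (hS.lt_of_mem _ (by simp)) (hS.visited_of_mem _ (by simp))
            refine ⟨by omega, k - 1, by omega, ?_, ?_, .inr (.inl ⟨?_, ?_, S', ?_, ?_⟩)⟩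
            · intro k h1 h2 h3
              funext i j
              simp [h1, harr₁, harr k h1 h2 h3]
            · intro x hx
              rw [if_neg (by omega), if_neg (by omega), if_neg (by omega),
                hreg₁ x (by omega) (by omega) (by omega), hreg x hx]
            · norm_num [h16]
            · norm_num [hne]
            · norm_num
              exact hS'
            · norm_num
              rw [List.length_cons] at hk
              omega
      · exact absurd h0' h0
  · exact ⟨fun _ _ _ _ => rfl, fun _ _ => rfl, .inl ⟨h16, h8, hP, hmark, le_rfl⟩⟩
  · rintro s' c ⟨hc, hb, k, -, -, hI⟩
    simp only [Test.Holds, Expr.eval, not_not] at hb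
    refine ⟨hc, ?_⟩
    obtain ⟨h16, -, hP, -⟩ | ⟨-, h0, -⟩ | ⟨h16, -, -, hn⟩ := hI
    · rw [hb.1] at hP
      exact ⟨fun _ => h16, fun _ => hP.saturable⟩
    · exact absurd hb.2 h0
    · exact ⟨fun h => absurd h hn, fun h => by omega⟩

end RAM

namespace FairDivision

/-! ### Allocations and matchings -/

theorem bundleUtility_eq_card {A R : Type*} {u : A → R → ℕ} (hu : IsBinary u) (a : A)
    (B : Finset R) : bundleUtility u a B = (B.filter fun r => u a r = 1).card := by
  rw [bundleUtility, Finset.card_filter]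
  refine Finset.sum_congr rfl fun r _ => ?_
  obtain h | h := hu a r <;> simp [h]

/-- With binary utilities, a bundle worth at least `t` contains `t` liked resources, chosen here by
an embedding of `Fin t`. Conversely, bundles of `t` liked resources exclude envy by cardinality. -/
theorem hasEnvyFreeESW_iff {A R : Type*} [Fintype A] [Nonempty A] {u : A → R → ℕ}
    (hu : IsBinary u) (t : ℕ) :
    HasEnvyFreeESW u t ↔
      ∃ f : A × Fin t → R, Function.Injective f ∧ ∀ x, u x.1 (f x) = 1 := by
  classical
  constructor
  · rintro ⟨π, hπ, -, ht⟩
    have hcard : ∀ a, t ≤ ((π a).filter fun r => u a r = 1).card := fun a => by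
      rw [← bundleUtility_eq_card hu]
      exact ht.trans (Finset.inf'_le _ (Finset.mem_univ a))
    have hemb : ∀ a, Nonempty (Fin t ↪ ((π a).filter fun r => u a r = 1)) := fun a =>
      Function.Embedding.nonempty_of_card_le (by simpa using hcard a)
    have he : ∀ a i, ((hemb a).some i : R) ∈ π a ∧ u a ((hemb a).some i) = 1 := fun a i =>
      Finset.mem_filter.1 ((hemb a).some i).2
    refine ⟨fun x => (hemb x.1).some x.2, ?_, fun x => (he x.1 x.2).2⟩
    rintro ⟨a, i⟩ ⟨b, j⟩ h
    by_cases hab : a = b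
    · subst hab
      have hij : i = j := (hemb a).some.injective (Subtype.ext h)
      rw [hij]
    · refine absurd ?_ (Finset.disjoint_left.1 (hπ a b hab) (he a i).1)
      have h' : ((hemb a).some i : R) = (hemb b).some j := h
      rw [h']
      exact (he b j).1
  · rintro ⟨f, hf, hfu⟩
    let π : A → Finset R := fun a => Finset.univ.image fun i => f (a, i)
    have hown : ∀ a, bundleUtility u a (π a) = t := fun a => by
      rw [bundleUtility, Finset.sum_image fun i _ j _ h => by simpa using hf h]
      simp [fun i => hfu (a, i)]
    have hle : ∀ a b, bundleUtility u a (π b) ≤ t := fun a b => by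
      rw [bundleUtility_eq_card hu]
      refine (Finset.card_filter_le _ _).trans (Finset.card_image_le.trans ?_)
      simp
    refine ⟨π, fun a b hab => ?_, ?_, ?_⟩
    · rw [Finset.disjoint_left]
      intro r hr hr'
      simp only [π, Finset.mem_image, Finset.mem_univ, true_and] at hr hr'
      obtain ⟨i, rfl⟩ := hr
      obtain ⟨j, hj⟩ := hr'
      exact hab (Prod.ext_iff.1 (hf hj)).1.symm
    · rintro ⟨a, b, h⟩
      rw [hown a] at h
      exact absurd (hle a b) (by omega)
    · exact Finset.le_inf' _ _ fun a _ => (hown a).ge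

theorem hasAgentSaturatingMatching_iff {A R : Type*} (u : A → R → ℕ) (t : ℕ) :
    HasAgentSaturatingMatching u t ↔
      ∃ f : A × Fin t → R, Function.Injective f ∧ ∀ x, u x.1 (f x) = 1 := by
  constructor
  · rintro ⟨M, hM, hs⟩
    have h : ∀ x : A × Fin t, ∃ r : R, M.Adj (.inl x) (.inr r) := fun x => by
      obtain ⟨w, hw, -⟩ := hM (hs x)
      obtain y | r := w
      · exact (M.adj_sub hw).elim
      · exact ⟨r, hw⟩
    choose f hf using h
    refine ⟨f, fun x y e => ?_, fun x => M.adj_sub (hf x)⟩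
    have hx := (hf x).symm
    have hy := (hf y).symm
    rw [← e] at hy
    exact Sum.inl.inj (hM.eq_of_adj_left hx hy)
  · rintro ⟨f, hf, hfu⟩
    refine ⟨{
      verts := Set.range Sum.inl ∪ Set.range fun x => Sum.inr (f x)
      Adj := fun v w => ∃ x, (v = .inl x ∧ w = .inr (f x)) ∨ (v = .inr (f x) ∧ w = .inl x)
      adj_sub := ?_
      edge_vert := ?_
      symm := ?_ }, ?_, fun x => .inl ⟨x, rfl⟩⟩
    · rintro v w ⟨x, ⟨rfl, rfl⟩ | ⟨rfl, rfl⟩⟩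
      · exact hfu x
      · exact hfu x
    · rintro v w ⟨x, ⟨rfl, rfl⟩ | ⟨rfl, rfl⟩⟩
      · exact .inl ⟨x, rfl⟩
      · exact .inr ⟨x, rfl⟩
    · constructor
      rintro v w ⟨x, h | h⟩
      · exact ⟨x, .inr h.symm⟩
      · exact ⟨x, .inl h.symm⟩
    · rintro v (⟨x, rfl⟩ | ⟨x, rfl⟩)
      · refine ⟨.inr (f x), ⟨x, .inl ⟨rfl, rfl⟩⟩, ?_⟩
        rintro w ⟨y, ⟨h, rfl⟩ | ⟨h, rfl⟩⟩
        · rw [Sum.inl.inj h]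
        · cases h
      · refine ⟨.inl x, ⟨x, .inr ⟨rfl, rfl⟩⟩, ?_⟩
        rintro w ⟨y, ⟨h, rfl⟩ | ⟨h, rfl⟩⟩
        · cases h
        · rw [hf (Sum.inr.inj h)]

end FairDivision

/-! ### The complete procedure and its running time -/

namespace RAM

open BipartiteMatching FairDivision

/-- With the copies listed, the memory represents the matching problem with `t` copies of each agent. -/
theorem saturable_likes_iff {n m t : ℕ} (ht : 0 < t) (u : Fin n → Fin m → ℕ) (s : State)
    (h0 : s.arr 0 = (input u t).arr 0)
    (h1 : ∀ x, 1 ≤ x → x ≤ n * t → s.arr 1 x 0 = (x - 1) / t) :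
    Saturable (Likes s) (n * t) m ↔
      ∃ f : Fin n × Fin t → Fin m, Function.Injective f ∧ ∀ x, u x.1 (f x) = 1 := by
  have hdiv : ∀ x, 1 ≤ x → x ≤ n * t → (x - 1) / t < n := fun x hx hx' =>
    Nat.div_lt_of_lt_mul (by rw [Nat.mul_comm]; omega)
  have hlike : ∀ x (hx : 1 ≤ x) (hx' : x ≤ n * t) r (hr : r < m),
      Likes s x r ↔ u ⟨(x - 1) / t, hdiv x hx hx'⟩ ⟨r, hr⟩ = 1 := by
    intro x hx hx' r hr
    rw [Likes, h0, h1 x hx hx']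
    simp [input, hdiv x hx hx', hr]
  have hidx : ∀ a : Fin n, ∀ i : Fin t, a.1 * t + i.1 + 1 ≤ n * t := fun a i => by
    have : (a.1 + 1) * t ≤ n * t := Nat.mul_le_mul_right _ a.2
    rw [Nat.add_mul] at this
    omega
  have hquot : ∀ a i : ℕ, i < t → (a * t + i + 1 - 1) / t = a := fun a i hi => by
    rw [Nat.add_sub_cancel, Nat.mul_comm, Nat.mul_add_div ht, Nat.div_eq_of_lt hi, Nat.add_zero]
  constructor
  · rintro ⟨f, hf, finj⟩
    refine ⟨fun x => ⟨f (x.1 * t + x.2 + 1), (hf _ (by omega) (hidx x.1 x.2)).1⟩, ?_, ?_⟩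
    · rintro ⟨a, i⟩ ⟨b, j⟩ h
      have := finj _ _ (by omega) (hidx a i) (by omega) (hidx b j) (Fin.mk.inj h)
      have hab : a = b := by
        apply Fin.ext
        rw [← hquot a i i.2, ← hquot b j j.2, this]
      subst hab
      have hij : i = j := Fin.ext (by omega)
      rw [hij]
    · rintro ⟨a, i⟩
      obtain ⟨hlt, hl⟩ := hf (a * t + i + 1) (by omega) (hidx a i)
      rw [hlike _ (by omega) (hidx a i) _ hlt] at hl
      simpa only [hquot a i i.2] using hl
  · rintro ⟨f, hf, hfu⟩
    -- Left vertices start at 1, as `0` means no owner; vertex `x` is copy `(x - 1) % t` of agent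
    -- `(x - 1) / t`.
    let F : ∀ x, 1 ≤ x → x ≤ n * t → Fin m := fun x hx hx' =>
      f (⟨(x - 1) / t, hdiv x hx hx'⟩, ⟨(x - 1) % t, Nat.mod_lt _ ht⟩)
    refine ⟨fun x => if h : 1 ≤ x ∧ x ≤ n * t then F x h.1 h.2 else 0, ?_, ?_⟩
    · intro x hx hx'
      simp only [hx, hx', and_self, dite_true]
      refine ⟨(F x hx hx').2, ?_⟩
      rw [hlike x hx hx' _ (F x hx hx').2]
      exact hfu (⟨(x - 1) / t, hdiv x hx hx'⟩, ⟨(x - 1) % t, Nat.mod_lt _ ht⟩)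
    · intro x y hx hx' hy hy' h
      simp only [hx, hx', hy, hy', and_self, dite_true] at h
      have := Prod.ext_iff.1 (hf (Fin.ext h))
      have e1 := Fin.mk.inj this.1
      have e2 := Fin.mk.inj this.2
      have := Nat.div_add_mod (x - 1) t
      have := Nat.div_add_mod (y - 1) t
      rw [e1, e2] at *
      omega

theorem card_le_of_injective {n m t : ℕ} {f : Fin n × Fin t → Fin m}
    (hf : Function.Injective f) : n * t ≤ m := by
  simpa using Fintype.card_le_of_injective f hf

theorem auction_steps_le {m K N : ℕ} (hm : 1 ≤ m) (hK : 1 ≤ K) (hN : N ≤ m) :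
    (m * K + 2 * N) * (40 * m + 109) + 9 ≤ 456 * (m * m * K) := by
  have h1 : m * K + 2 * N ≤ 3 * (m * K) := by
    have := Nat.le_mul_of_pos_right m hK
    omega
  have h2 := Nat.mul_le_mul h1 (show 40 * m + 109 ≤ 149 * m by omega)
  have h3 : 3 * (m * K) * (149 * m) = 447 * (m * m * K) := by ring
  have h4 : 1 ≤ m * m * K := Nat.mul_pos (Nat.mul_pos hm hm) hK
  omega

theorem augment_steps_le {m K g : ℕ} (hm : 1 ≤ m) (hK : 1 ≤ K) (hg : g ≤ K) :
    g * (2 * m + 2) * (40 * m + 109) + 9 ≤ 605 * (m * m * K) := by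
  have h2 := Nat.mul_le_mul (Nat.mul_le_mul hg (show 2 * m + 2 ≤ 4 * m by omega))
    (show 40 * m + 109 ≤ 149 * m by omega)
  have h3 : K * (4 * m) * (149 * m) = 596 * (m * m * K) := by ring
  have h4 : 1 ≤ m * m * K := Nat.mul_pos (Nat.mul_pos hm hm) hK
  omega

/-- If `g` exceeded `K`, then `(K + 1) * K ≤ m`, twice what the choice of `K` allows. -/
theorem postponed_le {m K g : ℕ} (hK : 1 ≤ K) (hm : 2 * m ≤ K * K + K) (hg : g * K ≤ m) :
    g ≤ K := by
  by_contra hlt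
  have h1 : (K + 1) * K ≤ g * K := Nat.mul_le_mul_right _ (by omega)
  have h2 : 1 ≤ K * K := Nat.mul_pos hK hK
  rw [Nat.add_mul] at h1
  omega

/-- Correctness of the program, with a bound for the number of steps in terms of the price cap. -/
theorem decideESW_spec {n m : ℕ} (t : ℕ) [NeZero n] (u : Fin n → Fin m → ℕ) (hu : IsBinary u) :
    Yields decideESW (input u t) fun s' c =>
      (c ≤ 200 * (m + 1) ∨ ∃ K, 1 ≤ m ∧ K * K ≤ 2 * m + K ∧ c ≤ 2000 * (m * m * K)) ∧
      ((HasEnvyFreeESW u t ∧ s'.reg 0 = 1) ∨ (¬ HasEnvyFreeESW u t ∧ s'.reg 0 = 0)) := by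
  rw [hasEnvyFreeESW_iff hu]
  have i0 : (input u t).reg 0 = n := rfl
  have i1 : (input u t).reg 1 = m := rfl
  have i2 : (input u t).reg 2 = t := rfl
  have i3 : ∀ x, 3 ≤ x → (input u t).reg x = 0 := fun x hx => by
    simp only [input]
    rw [if_neg (by omega), if_neg (by omega), if_neg (by omega)]
  have ia : ∀ k, k ≠ 0 → ∀ i j, (input u t).arr k i j = 0 := fun k hk i j => by
    simp [input, hk]
  have hn : 0 < n := Nat.pos_of_ne_zero (NeZero.ne n)
  simp only [decideESW, yields_ite, yields_seq, yields_assign, Test.Holds, Expr.eval, Test.cost,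
    Expr.cost, setReg_reg, i2, if_true]
  constructor
  · rintro rfl
    exact ⟨.inl (by omega), .inl ⟨⟨fun x => x.2.elim0, fun x => x.2.elim0,
      fun x => x.2.elim0⟩, trivial⟩⟩
  intro ht
  have ht : 0 < t := by omega
  refine (copies_spec (input u t) ht (i3 _ (by decide)) (i3 _ (by decide))
    (i3 _ (by decide))).mono ?_
  rintro s₁ c₁ ⟨hc₁, harr₁, hreg₁, hN⟩
  simp only [i0, i1, i2] at hc₁ hN
  have a1 : s₁.reg 1 = m := hreg₁ 1 (by decide) (by decide) (by decide)
  constructor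
  · intro hlt
    obtain ⟨-, hN⟩ := hN.resolve_right (by omega)
    refine ⟨.inl (by omega), .inr ⟨?_, trivial⟩⟩
    rintro ⟨f, hf, -⟩
    have := card_le_of_injective hf
    omega
  intro hge
  obtain ⟨hNm, hN, hag⟩ := hN.resolve_left (by omega)
  refine (priceCap_spec s₁ ?_ ?_).mono ?_
  · rw [hreg₁ 6 (by decide) (by decide) (by decide), i3 _ (by decide)]
  · rw [hreg₁ 17 (by decide) (by decide) (by decide), i3 _ (by decide)]
  rintro s₂ c₂ ⟨hc₂, harr₂, hreg₂, h7, hK, hK'⟩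
  rw [a1] at hc₂ hK hK'
  have b1 : s₂.reg 1 = m := by rw [hreg₂ 1 (by decide) (by decide) (by decide), a1]
  have b3 : s₂.reg 3 = n * t := by rw [hreg₂ 3 (by decide) (by decide) (by decide), hN]
  have hz : ∀ x, 8 ≤ x → x ≠ 17 → s₂.reg x = 0 := fun x hx hx' => by
    rw [hreg₂ x (by omega) (by omega) hx', hreg₁ x (by omega) (by omega) (by omega), i3 x (by omega)]
  have hza : ∀ k, 2 ≤ k → ∀ i j, s₂.arr k i j = 0 := fun k hk i j => by
    rw [harr₂, harr₁ k (by omega), ia k (by omega)]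
  rw [hN] at hag hNm
  have hsat := saturable_likes_iff ht u s₂ (by rw [harr₂, harr₁ 0 (by decide)])
    (by rw [harr₂]; exact hag)
  rw [← hsat]
  have hm : 1 ≤ m := le_trans (Nat.mul_pos hn ht) hNm
  refine (auction_spec s₂ (hz _ (by decide) (by decide)) (hz _ (by decide) (by decide))
    (hz _ (by decide) (by decide)) h7 (fun r => hza _ (by decide) _ _)
    (fun r => hza _ (by decide) _ _)).mono ?_
  rintro s₃ c₃ ⟨hc₃, harr₃, hreg₃, h8, hA⟩
  have d1 : s₃.reg 1 = m := by rw [hreg₃ 1 (by decide), b1]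
  have d3 : s₃.reg 3 = n * t := by rw [hreg₃ 3 (by decide), b3]
  have d6 := hreg₃ 6 (by decide)
  have d7 : s₃.reg 7 = s₂.reg 6 := by rw [hreg₃ 7 (by decide), h7]
  rw [b1, b3] at hc₃ hA
  rw [d6]
  generalize s₂.reg 6 = K at *
  have hK1 : 1 ≤ K := by
    by_contra h
    have : K = 0 := by omega
    subst this
    omega
  -- Lets the linear costs of listing copies and computing the cap be absorbed into the constant
  -- 2000.
  have hmK : m ≤ m * m * K :=
    (Nat.le_mul_of_pos_right m hm).trans (Nat.le_mul_of_pos_right _ hK1)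
  have hc₃' : c₃ ≤ 456 * (m * m * K) :=
    hc₃.trans (auction_steps_le hm hK1 hNm)
  constructor
  · intro hlt
    refine ⟨.inr ⟨K, hm, hK', by omega⟩, .inr ⟨fun hs => ?_, trivial⟩⟩
    exact absurd (postponed_le hK1 hK (hA.mul_le hs)) (by omega)
  intro hge'
  have hL : Likes s₃ = Likes s₂ := by
    funext x r
    simp only [Likes, harr₃ 0 (by decide) (by decide) (by decide),
      harr₃ 1 (by decide) (by decide) (by decide)]
  refine (augment_spec s₃ ?_ h8 ?_ ?_).mono ?_
  · rw [hreg₃ 16 (by decide), hz 16 (by decide) (by decide)]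
  · rw [hL, d1, d3]
    exact hA.toIsPartial
  · rw [d1, d7]
    exact hA.price_le
  rintro s₄ c₄ ⟨hc₄, hres⟩
  rw [hL, d1, d3] at hres
  rw [d1] at hc₄
  have hc₄' : c₄ ≤ 605 * (m * m * K) :=
    hc₄.trans (augment_steps_le hm hK1 (by omega))
  rw [hres]
  constructor
  · intro h
    exact ⟨.inr ⟨K, hm, hK', by omega⟩, .inl ⟨h, trivial⟩⟩
  · intro h
    exact ⟨.inr ⟨K, hm, hK', by omega⟩, .inr ⟨h, trivial⟩⟩

theorem steps_le {m c : ℕ}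
    (h : c ≤ 200 * (m + 1) ∨ ∃ K, 1 ≤ m ∧ K * K ≤ 2 * m + K ∧ c ≤ 2000 * (m * m * K)) :
    (c : ℝ) ≤ 6000 * (max 1 (m : ℝ)) ^ (5 / 2 : ℝ) := by
  set M : ℝ := max 1 (m : ℝ)
  have hM1 : 1 ≤ M := le_max_left _ _
  have hmM : (m : ℝ) ≤ M := le_max_right _ _
  have hpow : M ^ (5 / 2 : ℝ) = M * M * √M := by
    rw [Real.sqrt_eq_rpow, show (5 / 2 : ℝ) = 1 + 1 + 1 / 2 by norm_num,
      Real.rpow_add (by linarith), Real.rpow_add (by linarith), Real.rpow_one]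
  have hs1 : 1 ≤ √M := Real.one_le_sqrt.2 hM1
  have hsq : √M * √M = M := Real.mul_self_sqrt (by linarith)
  rw [hpow]
  obtain h | ⟨K, hm, hK, hc⟩ := h
  · have hc : (c : ℝ) ≤ 200 * (m + 1) := by exact_mod_cast h
    have h1 : M ≤ M * M := by nlinarith
    have h2 : M * M ≤ M * M * √M := le_mul_of_one_le_right (by positivity) hs1
    linarith
  · have hKr : (K : ℝ) * K ≤ 2 * m + K := by exact_mod_cast hK
    have hcr : (c : ℝ) ≤ 2000 * (m * m * K) := by exact_mod_cast hc
    -- Otherwise `K * (K - 1)` would exceed `9 * M - 3 * √M ≥ 6 * M`, but it is at most `2 * m`. The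
    -- factor 3 turns 2000 into 6000.
    have hK3 : (K : ℝ) ≤ 3 * √M := by
      by_contra hlt
      push Not at hlt
      nlinarith
    have : (m : ℝ) * m * K ≤ M * M * (3 * √M) := by gcongr
    linarith

end RAM

theorem theorem2 :
    (∃ (p : RAM.Program) (C : ℝ), ∀ (n m t : ℕ) [NeZero n] (u : Fin n → Fin m → ℕ),
      FairDivision.IsBinary u →
        RAM.Decides p (RAM.input u t) (C * (max 1 (m : ℝ)) ^ (5 / 2 : ℝ))
          (FairDivision.HasEnvyFreeESW u t)) ∧
    (∀ (n m t : ℕ) [NeZero n] (u : Fin n → Fin m → ℕ), FairDivision.IsBinary u →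
      (FairDivision.HasEnvyFreeESW u t ↔ FairDivision.HasAgentSaturatingMatching u t)) := by
  refine ⟨⟨RAM.decideESW, 6000, fun n m t _ u hu => ?_⟩, fun n m t _ u hu => ?_⟩
  · obtain ⟨s', c, he, hc, hres⟩ := RAM.decideESW_spec t u hu
    exact ⟨s', c, he, RAM.steps_le hc, hres⟩
  · rw [FairDivision.hasEnvyFreeESW_iff hu, FairDivision.hasAgentSaturatingMatching_iff]
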